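/- Let $X$ and $L$ be independent real random variables on a probability space with $X>0$ almost surely, $\mathbb E[X]=1$, $X^{-1}$ integrable, $\mathbb E[X^4]<\infty$, $\operatorname{Var}[X]>0$, $L$ integrable and $\mathbb E[L]=0$. Let $L$ have a bounded, strictly positive density $f_L$. For $\alpha\in(0,1)$ let $q:=F_L^{-1}(1-\alpha)$ be the $(1-\alpha)$-quantile of $L$, and let $f_L$ be three times continuously differentiable in a neighbourhood of $q$. Put $Y:=(X-1)/\sqrt{\operatorname{Var}[X]}$ and $\mu_i:=\mathbb E[Y^i]$. For $\sigma_N>0$ let $X_{\sigma_N}:=1+\sigma_N Y$ be the version of the asset with normal volatility (standard deviation) $\sigma_N$, and for $\phi\ge 0$ let $$S(\phi):=\phi\,(X_{\sigma_N}-1)-X_{\sigma_N}L$$ be the surplus. Let $\mathrm{VaR}_\alpha[Z]:=\inf\{m\in\mathbb R:\mathbb P(Z+m<0)\le\alpha\}$ and let $\mathrm{id}$ be the identity function on $\mathbb R$. Then, for each fixed $\phi\ge 0$ and $\alpha\in(0,1)$, as $\sigma_N\downarrow 0$, $$\mathrm{VaR}_\alpha[S(\phi)]=q-\frac1{f_L(q)}\Bigg\{\frac{\sigma_N^2}{2}\big[(\phi-\mathrm{id})^2f_L\big]'(q)+\frac{\sigma_N^3\mu_3}{6}\big[(\phi-\mathrm{id})^3f_L\big]''(q)+\frac{\sigma_N^4}{24}\bigg[\mu_4\big((\phi-\mathrm{id})^4f_L\big)''-3\,\frac{\big(\big((\phi-\mathrm{id})^2f_L\big)'\big)^2}{f_L}\bigg]'(q)\Bigg\}+o(\sigma_N^4).$$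 -/

import Mathlib

open MeasureTheory ProbabilityTheory Filter Topology Asymptotics

namespace VaRExpansion

noncomputable section

/-- Quantile function of a distribution on the real line:
`F⁻¹(p) = inf {x | p ≤ F(x)}`, where `F` is the cumulative distribution function. -/
def quantile (ν : Measure ℝ) (p : ℝ) : ℝ :=
  sInf {x : ℝ | p ≤ cdf ν x}

/-- Value-at-risk of the financial position `Z` at level `a`: the smallest amount `m` of capital
which, added to `Z`, makes the probability of a negative outcome at most `a`.
Equivalently, minus the upper `a`-quantile of `Z`. -/
def valueAtRisk {Ω : Type*} [MeasurableSpace Ω] (P : Measure Ω) (a : ℝ) (Z : Ω → ℝ) : ℝ :=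
  sInf {m : ℝ | P.real {ω | Z ω + m < 0} ≤ a}

/-- The centred and normalized version `Y = (X - 1) / √Var[X]` of an asset value `X` of mean one. -/
def normalizedAsset {Ω : Type*} [MeasurableSpace Ω] (P : Measure Ω) (X : Ω → ℝ) : Ω → ℝ :=
  fun ω => (X ω - 1) / Real.sqrt (variance X P)

/-- The version `X_σ = 1 + σ Y` of the asset whose normal volatility (standard deviation)
equals `σ`. -/
def assetWithVolatility {Ω : Type*} [MeasurableSpace Ω] (P : Measure Ω) (X : Ω → ℝ) (s : ℝ) :
    Ω → ℝ :=
  fun ω => 1 + s * normalizedAsset P X ω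

/-- The surplus `S(φ) = φ (X - 1) - X L` when `φ` units are invested into the asset `X`
and the liability is `X L`. -/
def surplus {Ω : Type*} (X L : Ω → ℝ) (φ : ℝ) : Ω → ℝ :=
  fun ω => φ * (X ω - 1) - X ω * L ω

/-- The `i`-th centred normalized moment `μ_i = E[Y^i]` of the asset value `X`. -/
def normalizedMoment {Ω : Type*} [MeasurableSpace Ω] (P : Measure Ω) (X : Ω → ℝ) (i : ℕ) : ℝ :=
  ∫ ω, normalizedAsset P X ω ^ i ∂P

/-- The function `(φ - id)^k f`. -/
def weighted (φ : ℝ) (f : ℝ → ℝ) (k : ℕ) : ℝ → ℝ :=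
  fun y => (φ - y) ^ k * f y

end

end VaRExpansion

/-! Put `v = φ - q`, `d = m - q`, `u = s * Y`, and let `F` be the distribution function of `L`.
Where `1 + u > 0`, the position `S(φ) + m` is negative exactly when `L` exceeds `q + displacement v
d u`. By independence the shortfall probability is therefore `1 - E[F (q + displacement v d u)]`,
and `F q = 1 - a`.

The correction `d` is expected to be of order `s ^ 2`, so `d` gets weight two and `u` weight one,
and `F` is expanded up to weight four (`isLittleO_displaced_sub`). The pure term in `u ^ k` has
coefficient `((φ - id) ^ k f)^(k-1) (q) / k!`. Taking expectations removes the terms linear in `u`,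
and equating powers of `s` determines `d = shift c₂ c₃ c₄ s`. The quotient in the fourth order
coefficient comes from `d ^ 2` and `d * u ^ 2` at `d = c₂ * s ^ 2`.

Taylor's formula is only local while `Y` may be unbounded. Since `0 ≤ F ≤ 1`, the remainder has a
global bound `K * (d ^ 2 + u ^ 4)`, and dominated convergence with `Y ^ 4` integrable makes its mean
`o(s ^ 4)` (`isLittleO_integral_displaced_sub`). Finally, moving the capital by `k * s ^ 4` changes
the shortfall probability by `-f q * k * s ^ 4` to leading order, so monotonicity in the capital
traps the Value-at-Risk (`isLittleO_valueAtRisk_sub`). -/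

namespace VaRExpansion

/-! ### Weighted Taylor expansion of a distribution function -/

/-- Integrating a little-o estimate: if `F` vanishes at `q` and its derivative is
`o((x - q) ^ n)`, then `F` is `o((x - q) ^ (n + 1))`. -/
theorem isLittleO_pow_succ_of_hasDerivAt {F G : ℝ → ℝ} {q : ℝ} {n : ℕ}
    (hF : ∀ᶠ x in 𝓝 q, HasDerivAt F (G x) x) (h0 : F q = 0)
    (hG : G =o[𝓝 q] fun x => (x - q) ^ n) :
    F =o[𝓝 q] fun x => (x - q) ^ (n + 1) := by
  obtain ⟨r, hr, hball⟩ := Metric.eventually_nhds_iff_ball.1 hF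
  have hmem : Metric.ball q r ∈ 𝓝 q := Metric.ball_mem_nhds q hr
  have key := Convex.isLittleO_pow_succ_real (f := F) (f' := G) (x₀ := q) (n := n)
    (convex_ball q r) (Metric.mem_ball_self hr)
    (fun x hx => (hball x hx).hasDerivWithinAt) (by rwa [nhdsWithin_eq_nhds.2 hmem])
  rw [nhdsWithin_eq_nhds.2 hmem] at key
  simpa [h0] using key

/-- Peano form of the fourth order Taylor formula, with the derivatives given explicitly. -/
theorem isLittleO_taylor_four {F f f₁ f₂ f₃ : ℝ → ℝ} {q : ℝ}
    (hF : ∀ᶠ x in 𝓝 q, HasDerivAt F (f x) x) (hf : ∀ᶠ x in 𝓝 q, HasDerivAt f (f₁ x) x)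
    (hf₁ : ∀ᶠ x in 𝓝 q, HasDerivAt f₁ (f₂ x) x) (hf₂ : ∀ᶠ x in 𝓝 q, HasDerivAt f₂ (f₃ x) x)
    (hf₃ : ContinuousAt f₃ q) :
    (fun t => F (q + t) - F q - (f q * t + f₁ q / 2 * t ^ 2 + f₂ q / 6 * t ^ 3
      + f₃ q / 24 * t ^ 4)) =o[𝓝 0] fun t : ℝ => t ^ 4 := by
  -- Continuity of `f₃` at `q` is the case of order zero; each integration from here raises the
  -- order by one.
  have e0 : (fun x => f₃ x - f₃ q) =o[𝓝 q] fun x => (x - q) ^ 0 := by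
    simp only [pow_zero, isLittleO_one_iff]
    exact tendsto_sub_nhds_zero_iff.2 hf₃
  have hid : ∀ x : ℝ, HasDerivAt (fun y => y - q) 1 x := fun x => (hasDerivAt_id x).sub_const q
  have e1 : (fun x => f₂ x - f₂ q - f₃ q * (x - q)) =o[𝓝 q] fun x => (x - q) ^ 1 := by
    refine isLittleO_pow_succ_of_hasDerivAt (hf₂.mono fun x hx => ?_) (by simp) e0
    exact ((hx.sub_const _).sub ((hid x).const_mul _)).congr_deriv (by ring)
  have e2 : (fun x => f₁ x - f₁ q - (f₂ q * (x - q) + f₃ q / 2 * (x - q) ^ 2))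
      =o[𝓝 q] fun x => (x - q) ^ 2 := by
    refine isLittleO_pow_succ_of_hasDerivAt (hf₁.mono fun x hx => ?_) (by simp) e1
    refine ((hx.sub_const _).sub (((hid x).const_mul _).add
      (((hid x).fun_pow 2).const_mul _))).congr_deriv ?_
    norm_num; ring
  have e3 : (fun x => f x - f q - (f₁ q * (x - q) + f₂ q / 2 * (x - q) ^ 2
      + f₃ q / 6 * (x - q) ^ 3)) =o[𝓝 q] fun x => (x - q) ^ 3 := by
    refine isLittleO_pow_succ_of_hasDerivAt (hf.mono fun x hx => ?_) (by simp) e2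
    refine ((hx.sub_const _).sub ((((hid x).const_mul _).add
      (((hid x).fun_pow 2).const_mul _)).add (((hid x).fun_pow 3).const_mul _))).congr_deriv ?_
    norm_num; ring
  have e4 : (fun x => F x - F q - (f q * (x - q) + f₁ q / 2 * (x - q) ^ 2
      + f₂ q / 6 * (x - q) ^ 3 + f₃ q / 24 * (x - q) ^ 4)) =o[𝓝 q] fun x => (x - q) ^ 4 := by
    refine isLittleO_pow_succ_of_hasDerivAt (hF.mono fun x hx => ?_) (by simp) e3
    refine ((hx.sub_const _).sub (((((hid x).const_mul _).add
      (((hid x).fun_pow 2).const_mul _)).add (((hid x).fun_pow 3).const_mul _)).add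
      (((hid x).fun_pow 4).const_mul _))).congr_deriv ?_
    norm_num; ring
  have hlim : Tendsto (fun t : ℝ => q + t) (𝓝 0) (𝓝 q) := by
    have : Continuous fun t : ℝ => q + t := by fun_prop
    simpa using this.tendsto 0
  simpa [Function.comp_def] using e4.comp_tendsto hlim

/-- The displacement `t` for which `q + t = φ + (q + d - φ) / (1 + u)`, where `v = φ - q`. -/
noncomputable def displacement (v d u : ℝ) : ℝ := (d + u * v) / (1 + u)

/-- The expansion of `F (q + displacement v d u) - F q` up to weight four, where `d` has weight two
and `u` has weight one, in terms of the derivatives `f₀, …, f₃` of `F` at `q`. -/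
noncomputable def displacedTaylor (v f₀ f₁ f₂ f₃ d u : ℝ) : ℝ :=
  f₀ * d + f₁ / 2 * d ^ 2 + (v * f₀) * u + (-f₀ + v * f₁) * d * u
    + (-2 * v * f₀ + v ^ 2 * f₁ + (2 * f₀ - 4 * v * f₁ + v ^ 2 * f₂) * d) / 2 * u ^ 2
    + (6 * v * f₀ - 6 * v ^ 2 * f₁ + v ^ 3 * f₂) / 6 * u ^ 3
    + (-24 * v * f₀ + 36 * v ^ 2 * f₁ - 12 * v ^ 3 * f₂ + v ^ 4 * f₃) / 24 * u ^ 4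

theorem tendsto_displacement (v : ℝ) :
    Tendsto (fun p : ℝ × ℝ => displacement v p.1 p.2) (𝓝 0) (𝓝 0) := by
  have : ContinuousAt (fun p : ℝ × ℝ => displacement v p.1 p.2) 0 := by
    unfold displacement
    exact ContinuousAt.div (by fun_prop) (by fun_prop) (by simp)
  simpa [ContinuousAt, displacement] using this

/-- The gauge `d ^ 2 + u ^ 4` dominates the weight-four monomials `d ^ 2`, `u ^ 4` and `d * u ^ 2`;
an extra factor `d` or `u` then yields little-o. -/
theorem isBigO_fst_weight : (fun p : ℝ × ℝ => p.1 ^ 2) =O[𝓝 0] fun p => p.1 ^ 2 + p.2 ^ 4 :=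
  IsBigO.of_bound 1 <| Eventually.of_forall fun p => by
    rw [Real.norm_of_nonneg (by positivity), Real.norm_of_nonneg (by positivity)]
    nlinarith [sq_nonneg (p.2 ^ 2)]

theorem isBigO_snd_weight : (fun p : ℝ × ℝ => p.2 ^ 4) =O[𝓝 0] fun p => p.1 ^ 2 + p.2 ^ 4 :=
  IsBigO.of_bound 1 <| Eventually.of_forall fun p => by
    rw [Real.norm_of_nonneg (by positivity), Real.norm_of_nonneg (by positivity)]
    nlinarith [sq_nonneg p.1]

theorem isBigO_mul_weight :
    (fun p : ℝ × ℝ => p.1 * p.2 ^ 2) =O[𝓝 0] fun p => p.1 ^ 2 + p.2 ^ 4 :=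
  IsBigO.of_bound 1 <| Eventually.of_forall fun p => by
    rw [Real.norm_of_nonneg (by positivity : 0 ≤ p.1 ^ 2 + p.2 ^ 4), Real.norm_eq_abs, abs_le]
    constructor <;> nlinarith [sq_nonneg (p.1 - p.2 ^ 2), sq_nonneg (p.1 + p.2 ^ 2),
      sq_nonneg p.1, sq_nonneg (p.2 ^ 2)]

/-- The numerator satisfies `(d + u * v) ^ 4 ≤ 8 * (d ^ 4 + (u * v) ^ 4)`, and `d ^ 4` is `O(d ^
2)`. This turns the Taylor remainder `o(t ^ 4)` into little-o of the gauge. -/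
theorem isBigO_displacement_pow_four (v : ℝ) :
    (fun p : ℝ × ℝ => displacement v p.1 p.2 ^ 4) =O[𝓝 0] fun p => p.1 ^ 2 + p.2 ^ 4 := by
  have h1 : (fun p : ℝ × ℝ => ((1 + p.2) ^ 4)⁻¹) =O[𝓝 0] fun _ => (1 : ℝ) := by
    have : ContinuousAt (fun p : ℝ × ℝ => ((1 + p.2) ^ 4)⁻¹) 0 :=
      ContinuousAt.inv₀ (by fun_prop) (by simp)
    exact this.tendsto.isBigO_one ℝ
  have h2 : (fun p : ℝ × ℝ => 8 * (p.1 ^ 2 * p.1 ^ 2 + v ^ 4 * p.2 ^ 4))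
      =O[𝓝 0] fun p => p.1 ^ 2 + p.2 ^ 4 := by
    have h3 : (fun p : ℝ × ℝ => p.1 ^ 2) =O[𝓝 0] fun _ => (1 : ℝ) := by
      have : ContinuousAt (fun p : ℝ × ℝ => p.1 ^ 2) 0 := by fun_prop
      exact this.tendsto.isBigO_one ℝ
    have h4 := h3.mul isBigO_fst_weight
    simp only [one_mul] at h4
    exact (h4.add (isBigO_snd_weight.const_mul_left _)).const_mul_left _
  have h5 : (fun p : ℝ × ℝ => (p.1 + p.2 * v) ^ 4) =O[𝓝 0] fun p => p.1 ^ 2 + p.2 ^ 4 := by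
    refine IsBigO.trans (IsBigO.of_bound 1 <| Eventually.of_forall fun p => ?_) h2
    rw [Real.norm_of_nonneg (by positivity), Real.norm_of_nonneg (by positivity), one_mul]
    have : ∀ x y : ℝ, (x + y) ^ 4 ≤ 8 * (x ^ 2 * x ^ 2 + y ^ 4) := fun x y => by
      nlinarith [sq_nonneg (x - y), sq_nonneg (x ^ 2 - y ^ 2), sq_nonneg (x + y),
        mul_nonneg (sq_nonneg (x - y)) (sq_nonneg (x + y)),
        sq_nonneg ((x - y) ^ 2), sq_nonneg (x * (x - y)), sq_nonneg (y * (x - y))]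
    calc _ ≤ _ := this p.1 (p.2 * v)
      _ = _ := by ring
  have := h1.mul h5
  simp only [one_mul] at this
  refine this.congr_left fun p => ?_
  rw [displacement, div_pow]; ring

/-- The remainder of the polynomial expansion is negligible. -/
theorem isLittleO_displacedTaylor_sub (v f₀ f₁ f₂ f₃ : ℝ) :
    (fun p : ℝ × ℝ => f₀ * displacement v p.1 p.2 + f₁ / 2 * displacement v p.1 p.2 ^ 2
        + f₂ / 6 * displacement v p.1 p.2 ^ 3 + f₃ / 24 * displacement v p.1 p.2 ^ 4
        - displacedTaylor v f₀ f₁ f₂ f₃ p.1 p.2)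
      =o[𝓝 0] fun p => p.1 ^ 2 + p.2 ^ 4 := by
  -- Multiplied by `(1 + u) ^ 4`, the difference is the polynomial `u ^ 5 * A + d * u ^ 3 * B + d ^
  -- 2 * (u * C + d * D)`, in which every monomial has weight at least five.
  set A : ℝ × ℝ → ℝ := fun p =>
    v*f₀ - 2*v^2*f₁ + v^3*f₂ - 1/6*v^4*f₃ + 3*p.2*v*f₀ - 11/2*p.2*v^2*f₁ + 7/3*p.2*v^3*f₂
      - 1/4*p.2*v^4*f₃ + 3*p.2^2*v*f₀ - 5*p.2^2*v^2*f₁ + 11/6*p.2^2*v^3*f₂ - 1/6*p.2^2*v^4*f₃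
      + p.2^3*v*f₀ - 3/2*p.2^3*v^2*f₁ + 1/2*p.2^3*v^3*f₂ - 1/24*p.2^3*v^4*f₃ with hA
  set B : ℝ × ℝ → ℝ := fun p =>
    -f₀ + 3*v*f₁ - 3/2*v^2*f₂ + 1/6*v^3*f₃ - 3*p.2*f₀ + 8*p.2*v*f₁ - 3*p.2*v^2*f₂ - 3*p.2^2*f₀
      + 7*p.2^2*v*f₁ - 2*p.2^2*v^2*f₂ - p.2^3*f₀ + 2*p.2^3*v*f₁ - 1/2*p.2^3*v^2*f₂ with hB
  set C : ℝ × ℝ → ℝ := fun p =>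
    -f₁ + 1/2*v*f₂ - 5/2*p.2*f₁ + 1/2*p.2*v*f₂ + 1/4*p.2*v^2*f₃ - 2*p.2^2*f₁ - 1/2*p.2^3*f₁ with hC
  set D : ℝ × ℝ → ℝ := fun p =>
    1/6*f₂ + 1/6*p.2*f₂ + 1/6*p.2*v*f₃ + 1/24*p.1*f₃ with hD
  have hinv : ContinuousAt (fun p : ℝ × ℝ => ((1 + p.2) ^ 4)⁻¹) 0 :=
    ContinuousAt.inv₀ (by fun_prop) (by simp)
  have small : ∀ g : ℝ × ℝ → ℝ, ContinuousAt g 0 → g 0 = 0 → g =o[𝓝 0] fun _ => (1 : ℝ) :=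
    fun g hg h0 => (isLittleO_one_iff ℝ).2 (by simpa [ContinuousAt, h0] using hg)
  have t1 := (small (fun p => p.2 * A p * ((1 + p.2) ^ 4)⁻¹)
    (by rw [hA]; exact ContinuousAt.mul (by fun_prop) hinv) (by simp)).mul_isBigO isBigO_snd_weight
  have t2 := (small (fun p => p.2 * B p * ((1 + p.2) ^ 4)⁻¹)
    (by rw [hB]; exact ContinuousAt.mul (by fun_prop) hinv) (by simp)).mul_isBigO isBigO_mul_weight
  have t3 := (small (fun p => (p.2 * C p + p.1 * D p) * ((1 + p.2) ^ 4)⁻¹)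
    (by rw [hC, hD]; exact ContinuousAt.mul (by fun_prop) hinv)
    (by simp)).mul_isBigO isBigO_fst_weight
  have key := (t1.add t2).add t3
  simp only [one_mul] at key
  refine key.congr' ?_ EventuallyEq.rfl
  have hne : ∀ᶠ p : ℝ × ℝ in 𝓝 0, 1 + p.2 ≠ 0 := by
    have : ContinuousAt (fun p : ℝ × ℝ => 1 + p.2) 0 := by fun_prop
    exact this.eventually_ne (by simp)
  filter_upwards [hne] with p hp
  simp only [hA, hB, hC, hD, displacement, displacedTaylor]
  field_simp
  ring

/-- Local expansion of a distribution function under a displacement of its argument. -/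
theorem isLittleO_displaced_sub {F f f₁ f₂ f₃ : ℝ → ℝ} {q : ℝ} (v : ℝ)
    (hF : ∀ᶠ x in 𝓝 q, HasDerivAt F (f x) x) (hf : ∀ᶠ x in 𝓝 q, HasDerivAt f (f₁ x) x)
    (hf₁ : ∀ᶠ x in 𝓝 q, HasDerivAt f₁ (f₂ x) x) (hf₂ : ∀ᶠ x in 𝓝 q, HasDerivAt f₂ (f₃ x) x)
    (hf₃ : ContinuousAt f₃ q) :
    (fun p : ℝ × ℝ => F (q + displacement v p.1 p.2) - F q
        - displacedTaylor v (f q) (f₁ q) (f₂ q) (f₃ q) p.1 p.2)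
      =o[𝓝 0] fun p => p.1 ^ 2 + p.2 ^ 4 := by
  have h1 := ((isLittleO_taylor_four hF hf hf₁ hf₂ hf₃).comp_tendsto
    (tendsto_displacement v)).trans_isBigO (isBigO_displacement_pow_four v)
  refine (h1.add (isLittleO_displacedTaylor_sub v (f q) (f₁ q) (f₂ q) (f₃ q))).congr_left
    fun p => ?_
  simp only [Function.comp_apply]
  ring

/-- A polynomial bound for the displaced Taylor polynomial away from the origin. -/
theorem exists_abs_displacedTaylor_le (v f₀ f₁ f₂ f₃ : ℝ) :
    ∃ K, 0 ≤ K ∧ ∀ d u, |d| ≤ 1 → |displacedTaylor v f₀ f₁ f₂ f₃ d u| ≤ K * (1 + u ^ 4) := by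
  refine ⟨|f₀| + |f₁ / 2| + |v * f₀| + |-f₀ + v * f₁| +
    (|(-2 * v * f₀ + v ^ 2 * f₁) / 2| + |(2 * f₀ - 4 * v * f₁ + v ^ 2 * f₂) / 2|)
    + |(6 * v * f₀ - 6 * v ^ 2 * f₁ + v ^ 3 * f₂) / 6|
    + |(-24 * v * f₀ + 36 * v ^ 2 * f₁ - 12 * v ^ 3 * f₂ + v ^ 4 * f₃) / 24|,
    by positivity, fun d u hd => ?_⟩
  have term : ∀ c x : ℝ, |x| ≤ 1 + u ^ 4 → |c * x| ≤ |c| * (1 + u ^ 4) := fun c x hx => by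
    rw [abs_mul]; exact mul_le_mul_of_nonneg_left hx (abs_nonneg c)
  have hu0 := abs_nonneg u
  have hu4 : u ^ 4 = |u| ^ 4 := by rw [← abs_pow, abs_of_nonneg (by positivity)]
  have pw : ∀ j ≤ 4, |u| ^ j ≤ 1 + u ^ 4 := fun j hj => by
    rw [hu4]
    rcases le_total |u| 1 with h | h
    · have := pow_le_one₀ hu0 h (n := j); have := pow_nonneg hu0 4; linarith
    · have := pow_le_pow_right₀ h hj; linarith
  have pd : ∀ i, ∀ j ≤ 4, |d ^ i * u ^ j| ≤ 1 + u ^ 4 := fun i j hj => by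
    rw [abs_mul, abs_pow, abs_pow]
    calc _ ≤ 1 * |u| ^ j :=
          mul_le_mul_of_nonneg_right (pow_le_one₀ (abs_nonneg d) hd) (pow_nonneg hu0 j)
      _ ≤ _ := by rw [one_mul]; exact pw j hj
  have e : displacedTaylor v f₀ f₁ f₂ f₃ d u =
      f₀ * (d ^ 1 * u ^ 0) + f₁ / 2 * (d ^ 2 * u ^ 0) + v * f₀ * (d ^ 0 * u ^ 1)
      + (-f₀ + v * f₁) * (d ^ 1 * u ^ 1)
      + ((-2 * v * f₀ + v ^ 2 * f₁) / 2 * (d ^ 0 * u ^ 2)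
      + (2 * f₀ - 4 * v * f₁ + v ^ 2 * f₂) / 2 * (d ^ 1 * u ^ 2))
      + (6 * v * f₀ - 6 * v ^ 2 * f₁ + v ^ 3 * f₂) / 6 * (d ^ 0 * u ^ 3)
      + (-24 * v * f₀ + 36 * v ^ 2 * f₁ - 12 * v ^ 3 * f₂ + v ^ 4 * f₃) / 24
        * (d ^ 0 * u ^ 4) := by
    unfold displacedTaylor; ring
  rw [e]
  simp only [add_mul _ _ (1 + u ^ 4)]
  have add2 : ∀ {x y a b : ℝ}, |x| ≤ a → |y| ≤ b → |x + y| ≤ a + b := fun h h' =>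
    (abs_add_le _ _).trans (add_le_add h h')
  exact add2 (add2 (add2 (add2 (add2 (add2 (term _ _ (pd 1 0 (by norm_num)))
    (term _ _ (pd 2 0 (by norm_num)))) (term _ _ (pd 0 1 (by norm_num))))
    (term _ _ (pd 1 1 (by norm_num)))) (add2 (term _ _ (pd 0 2 (by norm_num)))
    (term _ _ (pd 1 2 (by norm_num))))) (term _ _ (pd 0 3 (by norm_num))))
    (term _ _ (pd 0 4 (by norm_num)))

/-- Global bound for the remainder of the displaced Taylor expansion of a function with values in
the unit interval. -/
theorem exists_abs_displaced_sub_le {F : ℝ → ℝ} {q v f₀ f₁ f₂ f₃ : ℝ}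
    (h0 : ∀ x, 0 ≤ F x) (h1 : ∀ x, F x ≤ 1)
    (hlo : (fun p : ℝ × ℝ => F (q + displacement v p.1 p.2) - F q
        - displacedTaylor v f₀ f₁ f₂ f₃ p.1 p.2) =o[𝓝 0] fun p => p.1 ^ 2 + p.2 ^ 4) :
    ∃ r > 0, ∃ K, ∀ d u, |d| < r →
      |F (q + displacement v d u) - F q - displacedTaylor v f₀ f₁ f₂ f₃ d u|
        ≤ K * (d ^ 2 + u ^ 4) := by
  obtain ⟨K, hK, hP⟩ := exists_abs_displacedTaylor_le v f₀ f₁ f₂ f₃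
  obtain ⟨r, hr, hball⟩ := Metric.eventually_nhds_iff_ball.1 (hlo.bound one_pos)
  refine ⟨min r 1, lt_min hr one_pos, max 1 ((1 + K) / r ^ 4 + K), fun d u hd => ?_⟩
  have hd1 : |d| < r := hd.trans_le (min_le_left _ _)
  have hnn : 0 ≤ d ^ 2 + u ^ 4 := by positivity
  by_cases hu : |u| < r
  · have := hball (d, u) (by
      rw [mem_ball_zero_iff, Prod.norm_def]; exact max_lt hd1 hu)
    rw [Real.norm_eq_abs, Real.norm_of_nonneg hnn] at this
    exact this.trans (mul_le_mul_of_nonneg_right (le_max_left _ _) hnn)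
  -- Away from the origin no smoothness is needed: the increment of `F` is at most one, the
  -- polynomial is at most `K * (1 + u ^ 4)`, and `1 ≤ u ^ 4 / r ^ 4` absorbs the constants.
  · have hu4 : r ^ 4 ≤ u ^ 4 := by
      have := pow_le_pow_left₀ hr.le (not_lt.1 hu) 4
      rwa [← abs_pow, abs_of_nonneg (by positivity : 0 ≤ u ^ 4)] at this
    have hF : |F (q + displacement v d u) - F q| ≤ 1 := abs_le.2
      ⟨by linarith [h0 (q + displacement v d u), h1 q],
        by linarith [h1 (q + displacement v d u), h0 q]⟩
    have h1u : 1 ≤ u ^ 4 / r ^ 4 := (one_le_div (by positivity)).2 hu4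
    calc _ ≤ |F (q + displacement v d u) - F q| + |displacedTaylor v f₀ f₁ f₂ f₃ d u| :=
          abs_sub _ _
      _ ≤ 1 + K * (1 + u ^ 4) := add_le_add hF (hP d u (hd.le.trans (min_le_right _ _)))
      _ ≤ (1 + K) * (u ^ 4 / r ^ 4) + K * u ^ 4 := by nlinarith
      _ = ((1 + K) / r ^ 4 + K) * u ^ 4 := by ring
      _ ≤ ((1 + K) / r ^ 4 + K) * (d ^ 2 + u ^ 4) :=
          mul_le_mul_of_nonneg_left (by nlinarith [sq_nonneg d]) (by positivity)
      _ ≤ _ := mul_le_mul_of_nonneg_right (le_max_right _ _) hnn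

/-! ### Expectation of the expansion along a quartic shift -/

/-- A quartic polynomial in the volatility `s` without constant and linear term. -/
noncomputable def shift (c₂ c₃ c₄ s : ℝ) : ℝ := c₂ * s ^ 2 + c₃ * s ^ 3 + c₄ * s ^ 4

theorem shift_sq_le {c₂ c₃ c₄ s : ℝ} (hs : |s| ≤ 1) :
    shift c₂ c₃ c₄ s ^ 2 ≤ (|c₂| + |c₃| + |c₄|) ^ 2 * s ^ 4 := by
  have h : |c₂ + c₃ * s + c₄ * s ^ 2| ≤ |c₂| + |c₃| + |c₄| := by
    refine (abs_add_three _ _ _).trans ?_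
    rw [abs_mul, abs_mul, abs_pow]
    have h2 : |s| ^ 2 ≤ 1 := pow_le_one₀ (abs_nonneg s) hs
    gcongr
    · exact mul_le_of_le_one_right (abs_nonneg _) hs
    · exact mul_le_of_le_one_right (abs_nonneg _) h2
  calc shift c₂ c₃ c₄ s ^ 2 = |c₂ + c₃ * s + c₄ * s ^ 2| ^ 2 * s ^ 4 := by
        rw [sq_abs]; unfold shift; ring
    _ ≤ _ := by gcongr

theorem tendsto_shift (c₂ c₃ c₄ : ℝ) : Tendsto (shift c₂ c₃ c₄) (𝓝 0) (𝓝 0) := by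
  have : Continuous (shift c₂ c₃ c₄) := by unfold shift; fun_prop
  simpa [shift] using this.tendsto 0

section Expectation

variable {Ω : Type*} [MeasurableSpace Ω]

/-- The expected remainder of the displaced Taylor expansion is of smaller order than `s ^ 4`. -/
theorem isLittleO_integral_displaced_sub {P : Measure Ω} [IsProbabilityMeasure P] {Y : Ω → ℝ}
    (hY : Measurable Y) (hY4 : Integrable (fun ω => Y ω ^ 4) P)
    {F : ℝ → ℝ} (hFm : Measurable F) {q v f₀ f₁ f₂ f₃ : ℝ}
    (h0 : ∀ x, 0 ≤ F x) (h1 : ∀ x, F x ≤ 1)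
    (hlo : (fun p : ℝ × ℝ => F (q + displacement v p.1 p.2) - F q
        - displacedTaylor v f₀ f₁ f₂ f₃ p.1 p.2) =o[𝓝 0] fun p => p.1 ^ 2 + p.2 ^ 4)
    (c₂ c₃ c₄ : ℝ) :
    (fun s => ∫ ω, (F (q + displacement v (shift c₂ c₃ c₄ s) (s * Y ω)) - F q
        - displacedTaylor v f₀ f₁ f₂ f₃ (shift c₂ c₃ c₄ s) (s * Y ω)) ∂P)
      =o[𝓝[>] 0] fun s => s ^ 4 := by
  obtain ⟨r, hr, K, hK⟩ := exists_abs_displaced_sub_le h0 h1 hlo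
  set R : ℝ → Ω → ℝ := fun s ω => F (q + displacement v (shift c₂ c₃ c₄ s) (s * Y ω)) - F q
        - displacedTaylor v f₀ f₁ f₂ f₃ (shift c₂ c₃ c₄ s) (s * Y ω) with hR
  set E : ℝ := (|c₂| + |c₃| + |c₄|) ^ 2 with hE
  have hpos : ∀ᶠ s in 𝓝[>] (0 : ℝ), 0 < s := self_mem_nhdsWithin
  have hle : ∀ᶠ s in 𝓝[>] (0 : ℝ), |s| ≤ 1 := by
    have : ∀ᶠ s : ℝ in 𝓝 0, |s| ≤ 1 := by
      have := Metric.closedBall_mem_nhds (0 : ℝ) one_pos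
      filter_upwards [this] with s hs
      simpa using hs
    exact this.filter_mono nhdsWithin_le_nhds
  have hsr : ∀ᶠ s in 𝓝[>] (0 : ℝ), |shift c₂ c₃ c₄ s| < r := by
    have := (tendsto_shift c₂ c₃ c₄).eventually (Metric.ball_mem_nhds 0 hr)
    refine (this.mono fun s hs => ?_).filter_mono nhdsWithin_le_nhds
    simpa using hs
  have hweight : ∀ s, |s| ≤ 1 → ∀ y : ℝ,
      shift c₂ c₃ c₄ s ^ 2 + (s * y) ^ 4 ≤ (E + y ^ 4) * s ^ 4 := fun s hs y => by
    have := shift_sq_le (c₂ := c₂) (c₃ := c₃) (c₄ := c₄) hs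
    rw [mul_pow]; linarith
  -- Dominated convergence: the global bound supplies the majorant `|K| * (E + Y ^ 4)`, and for
  -- fixed `ω` the local expansion along the curve `s ↦ (shift c₂ c₃ c₄ s, s * Y ω)` supplies the
  -- limit zero.
  have hlim : Tendsto (fun s => ∫ ω, R s ω / s ^ 4 ∂P) (𝓝[>] 0) (𝓝 (∫ _, (0 : ℝ) ∂P)) := by
    refine tendsto_integral_filter_of_dominated_convergence (fun ω => |K| * (E + Y ω ^ 4))
      (Eventually.of_forall fun s => ?_) ?_
      (((integrable_const E).add hY4).const_mul |K|) (ae_of_all _ fun ω => ?_)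
    · refine Measurable.aestronglyMeasurable ?_
      simp only [hR, displacement, displacedTaylor]
      fun_prop
    · filter_upwards [hpos, hle, hsr] with s hs hs1 hsr
      refine ae_of_all _ fun ω => ?_
      have hs4 : 0 < s ^ 4 := by positivity
      rw [norm_div, Real.norm_eq_abs, Real.norm_of_nonneg hs4.le, div_le_iff₀ hs4, mul_assoc]
      calc |R s ω| ≤ K * (shift c₂ c₃ c₄ s ^ 2 + (s * Y ω) ^ 4) := hK _ _ hsr
        _ ≤ |K| * (shift c₂ c₃ c₄ s ^ 2 + (s * Y ω) ^ 4) :=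
            mul_le_mul_of_nonneg_right (le_abs_self K) (by positivity)
        _ ≤ _ := mul_le_mul_of_nonneg_left (hweight s hs1 _) (abs_nonneg K)
    · have hcurve : Tendsto (fun s : ℝ => ((shift c₂ c₃ c₄ s, s * Y ω) : ℝ × ℝ))
          (𝓝[>] 0) (𝓝 0) := by
        refine Tendsto.prodMk_nhds ((tendsto_shift _ _ _).mono_left nhdsWithin_le_nhds) ?_
        have : Continuous fun s : ℝ => s * Y ω := by fun_prop
        simpa using (this.tendsto 0).mono_left nhdsWithin_le_nhds
      have hb : (fun s : ℝ => shift c₂ c₃ c₄ s ^ 2 + (s * Y ω) ^ 4)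
          =O[𝓝[>] 0] fun s => s ^ 4 := by
        refine IsBigO.of_bound (E + Y ω ^ 4) (hle.mono fun s hs => ?_)
        rw [Real.norm_of_nonneg (by positivity), Real.norm_of_nonneg (by positivity)]
        exact hweight s hs _
      exact ((hlo.comp_tendsto hcurve).trans_isBigO hb).tendsto_div_nhds_zero
  rw [integral_zero] at hlim
  refine (isLittleO_iff_tendsto' ?_).2 ?_
  · filter_upwards [hpos] with s hs h
    exact absurd h (by positivity)
  · simpa only [integral_div] using hlim

/-- The expectation of the displaced Taylor polynomial. -/
theorem integral_displacedTaylor {P : Measure Ω} [IsProbabilityMeasure P] {Y : Ω → ℝ}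
    (hY : MemLp Y 4 P) (hmean : ∫ ω, Y ω ∂P = 0) (hsq : ∫ ω, Y ω ^ 2 ∂P = 1)
    (v f₀ f₁ f₂ f₃ d s : ℝ) :
    Integrable (fun ω => displacedTaylor v f₀ f₁ f₂ f₃ d (s * Y ω)) P ∧
    ∫ ω, displacedTaylor v f₀ f₁ f₂ f₃ d (s * Y ω) ∂P =
      f₀ * d + f₁ / 2 * d ^ 2
      + (-2 * v * f₀ + v ^ 2 * f₁ + (2 * f₀ - 4 * v * f₁ + v ^ 2 * f₂) * d) / 2 * s ^ 2
      + (6 * v * f₀ - 6 * v ^ 2 * f₁ + v ^ 3 * f₂) / 6 * s ^ 3 * ∫ ω, Y ω ^ 3 ∂P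
      + (-24 * v * f₀ + 36 * v ^ 2 * f₁ - 12 * v ^ 3 * f₂ + v ^ 4 * f₃) / 24 * s ^ 4
        * ∫ ω, Y ω ^ 4 ∂P := by
  have hpow : ∀ n : ℕ, n ≤ 4 → Integrable (fun ω => Y ω ^ n) P := fun n hn => by
    have : MemLp Y n P := hY.mono_exponent (by exact_mod_cast hn)
    have h := this.integrable_norm_pow'
    refine h.mono' (hY.1.pow n) (ae_of_all _ fun ω => ?_)
    rw [norm_pow]
  have i1 := (hpow 1 (by norm_num)).const_mul ((v * f₀) * s + (-f₀ + v * f₁) * d * s)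
  have i2 := (hpow 2 (by norm_num)).const_mul
    ((-2 * v * f₀ + v ^ 2 * f₁ + (2 * f₀ - 4 * v * f₁ + v ^ 2 * f₂) * d) / 2 * s ^ 2)
  have i3 := (hpow 3 (by norm_num)).const_mul
    ((6 * v * f₀ - 6 * v ^ 2 * f₁ + v ^ 3 * f₂) / 6 * s ^ 3)
  have i4 := (hpow 4 (by norm_num)).const_mul
    ((-24 * v * f₀ + 36 * v ^ 2 * f₁ - 12 * v ^ 3 * f₂ + v ^ 4 * f₃) / 24 * s ^ 4)
  have i0 : Integrable (fun _ : Ω => f₀ * d + f₁ / 2 * d ^ 2) P := integrable_const _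
  have e : (fun ω => displacedTaylor v f₀ f₁ f₂ f₃ d (s * Y ω)) = fun ω =>
      f₀ * d + f₁ / 2 * d ^ 2
      + ((v * f₀) * s + (-f₀ + v * f₁) * d * s) * Y ω ^ 1
      + ((-2 * v * f₀ + v ^ 2 * f₁ + (2 * f₀ - 4 * v * f₁ + v ^ 2 * f₂) * d) / 2 * s ^ 2) * Y ω ^ 2
      + ((6 * v * f₀ - 6 * v ^ 2 * f₁ + v ^ 3 * f₂) / 6 * s ^ 3) * Y ω ^ 3
      + ((-24 * v * f₀ + 36 * v ^ 2 * f₁ - 12 * v ^ 3 * f₂ + v ^ 4 * f₃) / 24 * s ^ 4)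
        * Y ω ^ 4 := by
    funext ω; unfold displacedTaylor; ring
  rw [e]
  have j1 := i0.fun_add i1
  have j2 := j1.fun_add i2
  have j3 := j2.fun_add i3
  refine ⟨j3.fun_add i4, ?_⟩
  rw [integral_add j3 i4, integral_add j2 i3, integral_add j1 i2, integral_add i0 i1]
  simp only [integral_const_mul, integral_const, pow_one, hmean, hsq]
  simp

end Expectation

/-- If the coefficients of the shift solve the expansion up to fourth order, then only the
perturbation `k` of the last coefficient survives. -/
theorem isLittleO_shift_expansion {f₀ f₁ a₂ b₂ a₃ a₄ m₃ m₄ c₂ c₃ c₄ k : ℝ}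
    (h₂ : f₀ * c₂ + a₂ / 2 = 0) (h₃ : f₀ * c₃ + a₃ / 6 * m₃ = 0)
    (h₄ : f₀ * c₄ + f₁ / 2 * c₂ ^ 2 + b₂ / 2 * c₂ + a₄ / 24 * m₄ = 0) :
    (fun s => f₀ * shift c₂ c₃ (c₄ + k) s + f₁ / 2 * shift c₂ c₃ (c₄ + k) s ^ 2
      + (a₂ + b₂ * shift c₂ c₃ (c₄ + k) s) / 2 * s ^ 2 + a₃ / 6 * s ^ 3 * m₃
      + a₄ / 24 * s ^ 4 * m₄ - f₀ * k * s ^ 4) =o[𝓝[>] 0] fun s : ℝ => s ^ 4 := by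
  -- This is what remains, divided by `s ^ 4`, once `h₂`, `h₃`, `h₄` have cancelled the coefficients
  -- of `s ^ 2`, `s ^ 3`, `s ^ 4`.
  have hsmall : (fun s : ℝ => s * (f₁ / 2 * (2 * c₂ * c₃ + (c₃ ^ 2 + 2 * c₂ * (c₄ + k)) * s
      + 2 * c₃ * (c₄ + k) * s ^ 2 + (c₄ + k) ^ 2 * s ^ 3)
      + b₂ / 2 * (c₃ + (c₄ + k) * s))) =o[𝓝[>] 0] fun _ : ℝ => (1 : ℝ) := by
    refine (isLittleO_one_iff ℝ).2 (Tendsto.mono_left ?_ nhdsWithin_le_nhds)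
    have : Continuous (fun s : ℝ => s * (f₁ / 2 * (2 * c₂ * c₃ + (c₃ ^ 2 + 2 * c₂ * (c₄ + k)) * s
      + 2 * c₃ * (c₄ + k) * s ^ 2 + (c₄ + k) ^ 2 * s ^ 3)
      + b₂ / 2 * (c₃ + (c₄ + k) * s))) := by fun_prop
    simpa using this.tendsto 0
  have := hsmall.mul_isBigO (isBigO_refl (fun s : ℝ => s ^ 4) (𝓝[>] 0))
  simp only [one_mul] at this
  refine this.congr_left fun s => ?_
  unfold shift
  linear_combination (-s ^ 2) * h₂ - s ^ 3 * h₃ - s ^ 4 * h₄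

/-! ### Distribution function and quantile of a law with density -/

section Density

variable {ν : Measure ℝ} [IsProbabilityMeasure ν] {f : ℝ → ℝ}

theorem integrable_of_withDensity (hf : Measurable f) (hpos : ∀ x, 0 < f x)
    (hν : ν = volume.withDensity fun x => ENNReal.ofReal (f x)) : Integrable f := by
  refine ⟨hf.aestronglyMeasurable, ?_⟩
  rw [hasFiniteIntegral_iff_ofReal (ae_of_all _ fun x => (hpos x).le),
    ← setLIntegral_univ, ← withDensity_apply _ MeasurableSet.univ, ← hν]
  exact measure_lt_top _ _

theorem cdf_eq_integral_Iic (hf : Measurable f) (hpos : ∀ x, 0 < f x)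
    (hν : ν = volume.withDensity fun x => ENNReal.ofReal (f x)) (x : ℝ) :
    cdf ν x = ∫ y in Set.Iic x, f y := by
  rw [cdf_eq_real, integral_eq_lintegral_of_nonneg_ae (ae_of_all _ fun x => (hpos x).le)
    hf.aestronglyMeasurable, measureReal_def]
  conv_lhs => rw [hν]
  rw [withDensity_apply _ measurableSet_Iic]

theorem cdf_eq_add_intervalIntegral (hf : Measurable f) (hpos : ∀ x, 0 < f x)
    (hν : ν = volume.withDensity fun x => ENNReal.ofReal (f x)) (x y : ℝ) :
    cdf ν y = cdf ν x + ∫ z in x..y, f z := by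
  have hi := integrable_of_withDensity hf hpos hν
  rw [cdf_eq_integral_Iic hf hpos hν, cdf_eq_integral_Iic hf hpos hν,
    ← intervalIntegral.integral_Iic_sub_Iic hi.integrableOn hi.integrableOn]
  ring

theorem continuous_cdf_of_withDensity (hf : Measurable f) (hpos : ∀ x, 0 < f x)
    (hν : ν = volume.withDensity fun x => ENNReal.ofReal (f x)) : Continuous (cdf ν) := by
  have hi := integrable_of_withDensity hf hpos hν
  have : (cdf ν : ℝ → ℝ) = fun y => cdf ν 0 + ∫ z in (0 : ℝ)..y, f z :=
    funext fun y => cdf_eq_add_intervalIntegral hf hpos hν 0 y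
  rw [this]
  exact continuous_const.add
    (intervalIntegral.continuous_primitive (fun a b => hi.intervalIntegrable) 0)

/-- The fundamental theorem of calculus needs continuity of `f` only at the point itself, so local
smoothness at `q` suffices. -/
theorem hasDerivAt_cdf_of_withDensity (hf : Measurable f) (hpos : ∀ x, 0 < f x)
    (hν : ν = volume.withDensity fun x => ENNReal.ofReal (f x)) {x : ℝ} (hx : ContinuousAt f x) :
    HasDerivAt (cdf ν) (f x) x := by
  have hi := integrable_of_withDensity hf hpos hν
  have : (cdf ν : ℝ → ℝ) = fun y => cdf ν x + ∫ z in x..y, f z :=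
    funext fun y => cdf_eq_add_intervalIntegral hf hpos hν x y
  rw [this]
  exact (intervalIntegral.integral_hasDerivAt_right hi.intervalIntegrable
    hf.stronglyMeasurable.stronglyMeasurableAtFilter hx).const_add _

end Density

/-- A continuous distribution function takes the value `p` at its `p`-quantile. -/
theorem cdf_quantile {ν : Measure ℝ} (hc : Continuous (cdf ν)) {p : ℝ} (h0 : 0 < p) (h1 : p < 1) :
    cdf ν (quantile ν p) = p := by
  set S := {x : ℝ | p ≤ cdf ν x} with hS
  have hne : S.Nonempty :=
    (((tendsto_cdf_atTop ν).eventually (lt_mem_nhds h1)).exists).imp fun x hx => hx.le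
  have hbdd : BddBelow S := by
    obtain ⟨b, hb⟩ := ((tendsto_cdf_atBot ν).eventually (gt_mem_nhds h0)).exists
    exact ⟨b, fun x hx => le_of_not_gt fun hxb =>
      absurd ((hx : p ≤ cdf ν x).trans (monotone_cdf ν hxb.le)) (not_le.2 hb)⟩
  -- The infimum is attained because the superlevel set is closed, which gives one inequality; the
  -- other is the limit from the left, where the distribution function stays below `p`.
  have hmem : quantile ν p ∈ S := (isClosed_le continuous_const hc).csInf_mem hne hbdd
  refine le_antisymm ?_ hmem
  have hlim : Tendsto (cdf ν) (𝓝[<] quantile ν p) (𝓝 (cdf ν (quantile ν p))) :=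
    (hc.tendsto _).mono_left nhdsWithin_le_nhds
  refine le_of_tendsto hlim ?_
  filter_upwards [self_mem_nhdsWithin] with x hx
  exact (not_le.1 fun h : p ≤ cdf ν x => absurd (csInf_le hbdd h) (not_le.2 hx)).le

/-! ### Derivatives of `(φ - id) ^ k f` -/

section Derivatives

theorem eventually_hasDerivAt_of_contDiffAt {f : ℝ → ℝ} {q : ℝ} (hf : ContDiffAt ℝ 3 f q) :
    (∀ᶠ x in 𝓝 q, HasDerivAt f (deriv f x) x) ∧
    (∀ᶠ x in 𝓝 q, HasDerivAt (deriv f) (deriv (deriv f) x) x) ∧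
    (∀ᶠ x in 𝓝 q, HasDerivAt (deriv (deriv f)) (deriv (deriv (deriv f)) x) x) ∧
    ContinuousAt (deriv (deriv (deriv f))) q := by
  have h2 : ContDiffAt ℝ 2 (deriv f) q := hf.derivWithin (by norm_num)
  have h1 : ContDiffAt ℝ 1 (deriv (deriv f)) q := h2.derivWithin (by norm_num)
  have h0 : ContDiffAt ℝ 0 (deriv (deriv (deriv f))) q := h1.derivWithin (by norm_num)
  refine ⟨?_, ?_, ?_, h0.continuousAt⟩
  · exact (hf.eventually (by simp)).mono fun x hx =>
      (hx.differentiableAt (by simp)).hasDerivAt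
  · exact (h2.eventually (by simp)).mono fun x hx =>
      (hx.differentiableAt (by simp)).hasDerivAt
  · exact (h1.eventually (by simp)).mono fun x hx =>
      (hx.differentiableAt (by simp)).hasDerivAt

variable {φ q : ℝ} {f f₁ f₂ f₃ : ℝ → ℝ}

/-- Truncated subtraction in the exponents is harmless, here and below: whenever it truncates, a
numerical factor in front vanishes. -/
theorem hasDerivAt_sub_pow (φ x : ℝ) (k : ℕ) :
    HasDerivAt (fun y : ℝ => (φ - y) ^ k) (-(k * (φ - x) ^ (k - 1))) x :=
  (((hasDerivAt_id x).const_sub φ).fun_pow k).congr_deriv (by simp)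

theorem hasDerivAt_weighted (k : ℕ) {x : ℝ} (hf : HasDerivAt f (f₁ x) x) :
    HasDerivAt (weighted φ f k) (-(k * (φ - x) ^ (k - 1)) * f x + (φ - x) ^ k * f₁ x) x :=
  (hasDerivAt_sub_pow φ x k).mul hf

theorem deriv_weighted_eventuallyEq (k : ℕ) (hf : ∀ᶠ x in 𝓝 q, HasDerivAt f (f₁ x) x) :
    deriv (weighted φ f k) =ᶠ[𝓝 q]
      fun x => -(k * (φ - x) ^ (k - 1)) * f x + (φ - x) ^ k * f₁ x :=
  hf.mono fun _ hx => (hasDerivAt_weighted k hx).deriv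

theorem hasDerivAt_deriv_weighted (k : ℕ) (hf : ∀ᶠ x in 𝓝 q, HasDerivAt f (f₁ x) x)
    (hf₁ : HasDerivAt f₁ (f₂ q) q) :
    HasDerivAt (deriv (weighted φ f k))
      (k * ((k - 1 : ℕ) * (φ - q) ^ (k - 1 - 1)) * f q
        - 2 * (k * (φ - q) ^ (k - 1)) * f₁ q + (φ - q) ^ k * f₂ q) q := by
  refine HasDerivAt.congr_of_eventuallyEq ?_ (deriv_weighted_eventuallyEq k hf)
  refine (((((hasDerivAt_sub_pow φ q (k - 1)).const_mul (k : ℝ)).neg).mul hf.self_of_nhds).add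
    ((hasDerivAt_sub_pow φ q k).mul hf₁)).congr_deriv ?_
  simp only [Pi.neg_apply]
  ring

theorem iteratedDeriv_two_weighted_eventuallyEq (k : ℕ)
    (hf : ∀ᶠ x in 𝓝 q, HasDerivAt f (f₁ x) x) (hf₁ : ∀ᶠ x in 𝓝 q, HasDerivAt f₁ (f₂ x) x) :
    iteratedDeriv 2 (weighted φ f k) =ᶠ[𝓝 q] fun x =>
      k * ((k - 1 : ℕ) * (φ - x) ^ (k - 1 - 1)) * f x
        - 2 * (k * (φ - x) ^ (k - 1)) * f₁ x + (φ - x) ^ k * f₂ x := by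
  filter_upwards [hf.eventually_nhds, hf₁] with x hx hx₁
  rw [iteratedDeriv_succ, iteratedDeriv_one]
  exact (hasDerivAt_deriv_weighted k hx hx₁).deriv

theorem hasDerivAt_iteratedDeriv_two_weighted (k : ℕ)
    (hf : ∀ᶠ x in 𝓝 q, HasDerivAt f (f₁ x) x) (hf₁ : ∀ᶠ x in 𝓝 q, HasDerivAt f₁ (f₂ x) x)
    (hf₂ : HasDerivAt f₂ (f₃ q) q) :
    HasDerivAt (iteratedDeriv 2 (weighted φ f k))
      (-(k * ((k - 1 : ℕ) * ((k - 1 - 1 : ℕ) * (φ - q) ^ (k - 1 - 1 - 1)))) * f q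
        + 3 * (k * ((k - 1 : ℕ) * (φ - q) ^ (k - 1 - 1))) * f₁ q
        - 3 * (k * (φ - q) ^ (k - 1)) * f₂ q + (φ - q) ^ k * f₃ q) q := by
  refine HasDerivAt.congr_of_eventuallyEq ?_ (iteratedDeriv_two_weighted_eventuallyEq k hf hf₁)
  refine ((((((hasDerivAt_sub_pow φ q (k - 1 - 1)).const_mul ((k - 1 : ℕ) : ℝ)).const_mul
    (k : ℝ)).mul hf.self_of_nhds).sub ((((hasDerivAt_sub_pow φ q (k - 1)).const_mul
    (k : ℝ)).const_mul 2).mul hf₁.self_of_nhds)).add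
    ((hasDerivAt_sub_pow φ q k).mul hf₂)).congr_deriv ?_
  ring

/-- The fourth order coefficient of the Value-at-Risk expansion. -/
theorem deriv_fourth_order_coefficient (m₄ : ℝ) (hq : f q ≠ 0)
    (hf : ∀ᶠ x in 𝓝 q, HasDerivAt f (f₁ x) x) (hf₁ : ∀ᶠ x in 𝓝 q, HasDerivAt f₁ (f₂ x) x)
    (hf₂ : HasDerivAt f₂ (f₃ q) q) :
    deriv (fun y => m₄ * iteratedDeriv 2 (weighted φ f 4) y
        - 3 * (deriv (weighted φ f 2) y ^ 2 / f y)) q =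
      m₄ * (-24 * (φ - q) * f q + 36 * (φ - q) ^ 2 * f₁ q - 12 * (φ - q) ^ 3 * f₂ q
        + (φ - q) ^ 4 * f₃ q)
      - 3 * ((2 * (-2 * (φ - q) * f q + (φ - q) ^ 2 * f₁ q)
          * (2 * f q - 4 * (φ - q) * f₁ q + (φ - q) ^ 2 * f₂ q)) / f q
        - (-2 * (φ - q) * f q + (φ - q) ^ 2 * f₁ q) ^ 2 * f₁ q / f q ^ 2) := by
  have h4 := hasDerivAt_iteratedDeriv_two_weighted (φ := φ) 4 hf hf₁ hf₂
  have h2 := hasDerivAt_deriv_weighted (φ := φ) 2 hf hf₁.self_of_nhds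
  have e2 := (deriv_weighted_eventuallyEq (φ := φ) 2 hf).self_of_nhds
  rw [((h4.const_mul m₄).fun_sub (((h2.fun_pow 2).fun_div hf.self_of_nhds hq).const_mul 3)).deriv, e2]
  norm_num
  field_simp
  ring

end Derivatives

/-! ### Shortfall probability, Value-at-Risk and the normalized asset -/

section Probability

variable {Ω : Type*} [MeasurableSpace Ω]

/-- The probability that a random threshold is not exceeded by an independent variable. -/
theorem measureReal_lt_comp_eq {P : Measure Ω} [IsProbabilityMeasure P] {Y L : Ω → ℝ}
    (hY : Measurable Y) (hL : Measurable L) (hind : IndepFun Y L P) {g : ℝ → ℝ}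
    (hg : Measurable g) :
    P.real {ω | g (Y ω) < L ω} = 1 - ∫ ω, cdf (P.map L) (g (Y ω)) ∂P := by
  have : IsProbabilityMeasure (P.map L) := Measure.isProbabilityMeasure_map hL.aemeasurable
  have hmeas : MeasurableSet {p : ℝ × ℝ | p.2 ≤ g p.1} :=
    measurableSet_le measurable_snd (hg.comp measurable_fst)
  -- Tonelli for the product law: the slice over `y` is the half-line up to `g y`.
  have hle : P {ω | L ω ≤ g (Y ω)} = ∫⁻ ω, ENNReal.ofReal (cdf (P.map L) (g (Y ω))) ∂P := by
    have h1 : P {ω | L ω ≤ g (Y ω)} = P.map (fun ω => (Y ω, L ω)) {p : ℝ × ℝ | p.2 ≤ g p.1} := by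
      rw [Measure.map_apply (hY.prodMk hL) hmeas]; rfl
    rw [h1, (indepFun_iff_map_prod_eq_prod_map_map hY.aemeasurable hL.aemeasurable).1 hind,
      Measure.prod_apply hmeas, lintegral_map (measurable_measure_prodMk_left hmeas) hY]
    refine lintegral_congr fun ω => ?_
    rw [ofReal_cdf]; rfl
  have hcompl : {ω | g (Y ω) < L ω} = {ω | L ω ≤ g (Y ω)}ᶜ := by
    ext ω; simp
  rw [hcompl, probReal_compl_eq_one_sub (measurableSet_le hL (hg.comp hY) :
      MeasurableSet {ω | L ω ≤ g (Y ω)}), measureReal_def, hle,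
    integral_eq_lintegral_of_nonneg_ae (ae_of_all _ fun ω => cdf_nonneg _ _)
      ((monotone_cdf (P.map L)).measurable.comp (hg.comp hY) :
        Measurable fun ω => cdf (P.map L) (g (Y ω))).aestronglyMeasurable]

/-- The shortfall probability of the surplus in terms of the distribution function of `L`. -/
theorem measureReal_surplus_add_lt {P : Measure Ω} [IsProbabilityMeasure P] {X L : Ω → ℝ}
    (hX : Measurable X) (hL : Measurable L) (hind : IndepFun X L P) (φ q m s : ℝ)
    (hpos : ∀ᵐ ω ∂P, 0 < 1 + s * normalizedAsset P X ω) :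
    P.real {ω | surplus (assetWithVolatility P X s) L φ ω + m < 0} =
      1 - ∫ ω, cdf (P.map L)
        (q + displacement (φ - q) (m - q) (s * normalizedAsset P X ω)) ∂P := by
  have hn : Measurable fun x : ℝ => (x - 1) / Real.sqrt (variance X P) := by fun_prop
  have hg : Measurable fun y : ℝ => q + displacement (φ - q) (m - q) (s * y) := by
    unfold displacement; fun_prop
  have key := measureReal_lt_comp_eq (hn.comp hX) hL (hind.comp hn measurable_id) hg
  refine Eq.trans (measureReal_congr ?_) key
  filter_upwards [hpos] with ω hω
  refine propext ?_
  change surplus (assetWithVolatility P X s) L φ ω + m < 0 ↔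
    q + displacement (φ - q) (m - q) (s * normalizedAsset P X ω) < L ω
  have e : q + displacement (φ - q) (m - q) (s * normalizedAsset P X ω) =
      (m + s * normalizedAsset P X ω * φ) / (1 + s * normalizedAsset P X ω) := by
    unfold displacement; field_simp; ring
  rw [e, div_lt_iff₀ hω]
  simp only [surplus, assetWithVolatility]
  constructor <;> intro h <;> linarith

/-- Two-sided bounds for Value-at-Risk from shortfall probabilities. -/
theorem valueAtRisk_mem_Icc {P : Measure Ω} [IsFiniteMeasure P] {Z : Ω → ℝ} {a m₁ m₂ : ℝ}
    (h₁ : a < P.real {ω | Z ω + m₁ < 0}) (h₂ : P.real {ω | Z ω + m₂ < 0} ≤ a) :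
    valueAtRisk P a Z ∈ Set.Icc m₁ m₂ := by
  have hlb : ∀ m ∈ {m : ℝ | P.real {ω | Z ω + m < 0} ≤ a}, m₁ ≤ m := fun m hm =>
    le_of_not_gt fun hlt => absurd (h₁.trans_le (measureReal_mono
      (fun ω (hω : Z ω + m₁ < 0) => show Z ω + m < 0 by linarith))) (not_lt.2 hm)
  exact ⟨le_csInf ⟨m₂, h₂⟩ hlb, csInf_le ⟨m₁, hlb⟩ h₂⟩

section Asset

variable {P : Measure Ω} {X : Ω → ℝ}

theorem memLp_normalizedAsset [IsFiniteMeasure P] (hX : MemLp X 4 P) : MemLp (normalizedAsset P X) 4 P := by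
  have := (hX.sub (memLp_const (1 : ℝ))).const_mul (Real.sqrt (variance X P))⁻¹
  refine this.ae_eq (ae_of_all _ fun ω => ?_)
  simp [normalizedAsset, div_eq_inv_mul]

theorem integral_normalizedAsset [IsProbabilityMeasure P] (hX : Integrable X P) (hmean : ∫ ω, X ω ∂P = 1) :
    ∫ ω, normalizedAsset P X ω ∂P = 0 := by
  simp only [normalizedAsset]
  rw [integral_div, integral_sub hX (integrable_const _), hmean]
  simp

theorem integral_normalizedAsset_sq (hX : AEMeasurable X P) (hmean : ∫ ω, X ω ∂P = 1)
    (hvar : 0 < variance X P) : ∫ ω, normalizedAsset P X ω ^ 2 ∂P = 1 := by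
  simp only [normalizedAsset, div_pow, Real.sq_sqrt hvar.le]
  rw [integral_div]
  have := variance_eq_integral hX
  rw [hmean] at this
  rw [← this, div_self hvar.ne']

/-- For `0 < s < √Var[X]`, the value `1 + s * Y` is a convex combination of `1` and `X` with
positive weights. Its positivity permits dividing by it in the shortfall event. -/
theorem eventually_ae_one_add_mul_normalizedAsset_pos (hpos : ∀ᵐ ω ∂P, 0 < X ω)
    (hvar : 0 < variance X P) :
    ∀ᶠ s in 𝓝[>] (0 : ℝ), ∀ᵐ ω ∂P, 0 < 1 + s * normalizedAsset P X ω := by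
  have hsd : 0 < Real.sqrt (variance X P) := Real.sqrt_pos.2 hvar
  filter_upwards [Ioo_mem_nhdsGT hsd] with s hs
  filter_upwards [hpos] with ω hω
  have e : 1 + s * normalizedAsset P X ω =
      (Real.sqrt (variance X P) - s + s * X ω) / Real.sqrt (variance X P) := by
    unfold normalizedAsset; field_simp; ring
  rw [e]
  exact div_pos (add_pos (sub_pos.2 hs.2) (mul_pos hs.1 hω)) hsd

end Asset

end Probability

/-! ### Trapping the Value-at-Risk and solving for the coefficients -/

/-- If the shortfall probability at `m + k s ^ 4` differs from the level `a` by `-c k s ^ 4` up to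
smaller order terms, for every `k`, then `m` is the Value-at-Risk up to `o(s ^ 4)`. -/
theorem isLittleO_valueAtRisk_sub {Ω : Type*} [MeasurableSpace Ω] {P : Measure Ω}
    [IsFiniteMeasure P] {Z : ℝ → Ω → ℝ} {m : ℝ → ℝ} {a c : ℝ} (hc : 0 < c)
    (h : ∀ k : ℝ, (fun s => P.real {ω | Z s ω + (m s + k * s ^ 4) < 0} - a + c * k * s ^ 4)
      =o[𝓝[>] 0] fun s : ℝ => s ^ 4) :
    (fun s => valueAtRisk P a (Z s) - m s) =o[𝓝[>] 0] fun s : ℝ => s ^ 4 := by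
  refine isLittleO_iff.2 fun e he => ?_
  -- An error of half the drift `c * e * s ^ 4` leaves the shortfall probability strictly below `a`
  -- at `k = e` and strictly above `a` at `k = -e`.
  have hce : 0 < c * e / 2 := by positivity
  filter_upwards [(h e).bound hce, (h (-e)).bound hce, self_mem_nhdsWithin] with s h₁ h₂ hs
  have hs4 : 0 < s ^ 4 := pow_pos hs 4
  rw [Real.norm_eq_abs, Real.norm_of_nonneg hs4.le, abs_le] at h₁ h₂
  have hpos : 0 < c * e * s ^ 4 := by positivity
  obtain ⟨hl, hu⟩ := valueAtRisk_mem_Icc (P := P) (Z := Z s) (a := a)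
    (m₁ := m s + -e * s ^ 4) (m₂ := m s + e * s ^ 4)
    (by nlinarith [h₂.1]) (by nlinarith [h₁.2])
  rw [Real.norm_eq_abs, Real.norm_of_nonneg hs4.le, abs_le]
  constructor <;> linarith

/-- Expansion of the expected distribution function along a shift which solves the expansion
up to fourth order. -/
theorem isLittleO_integral_displaced {Ω : Type*} [MeasurableSpace Ω] {P : Measure Ω}
    [IsProbabilityMeasure P] {Y : Ω → ℝ} (hYm : Measurable Y) (hY : MemLp Y 4 P)
    (hmean : ∫ ω, Y ω ∂P = 0) (hsq : ∫ ω, Y ω ^ 2 ∂P = 1)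
    {F : ℝ → ℝ} (hFm : Measurable F) (h0 : ∀ x, 0 ≤ F x) (h1 : ∀ x, F x ≤ 1)
    {q v f₀ f₁ f₂ f₃ c₂ c₃ c₄ : ℝ}
    (hlo : (fun p : ℝ × ℝ => F (q + displacement v p.1 p.2) - F q
        - displacedTaylor v f₀ f₁ f₂ f₃ p.1 p.2) =o[𝓝 0] fun p => p.1 ^ 2 + p.2 ^ 4)
    (h₂ : f₀ * c₂ + (-2 * v * f₀ + v ^ 2 * f₁) / 2 = 0)
    (h₃ : f₀ * c₃ + (6 * v * f₀ - 6 * v ^ 2 * f₁ + v ^ 3 * f₂) / 6 * ∫ ω, Y ω ^ 3 ∂P = 0)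
    (h₄ : f₀ * c₄ + f₁ / 2 * c₂ ^ 2 + (2 * f₀ - 4 * v * f₁ + v ^ 2 * f₂) / 2 * c₂
      + (-24 * v * f₀ + 36 * v ^ 2 * f₁ - 12 * v ^ 3 * f₂ + v ^ 4 * f₃) / 24
        * ∫ ω, Y ω ^ 4 ∂P = 0) (k : ℝ) :
    (fun s => ∫ ω, F (q + displacement v (shift c₂ c₃ (c₄ + k) s) (s * Y ω)) ∂P - F q
      - f₀ * k * s ^ 4) =o[𝓝[>] 0] fun s => s ^ 4 := by
  have hY4 : Integrable (fun ω => Y ω ^ 4) P := by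
    have h : Integrable (fun ω => ‖Y ω‖ ^ 4) P := MemLp.integrable_norm_pow' (p := 4) hY
    exact h.mono' (hY.1.pow 4) (ae_of_all _ fun ω => by rw [norm_pow])
  have e1 := isLittleO_integral_displaced_sub hYm hY4 hFm h0 h1 hlo c₂ c₃ (c₄ + k)
  have e2 := isLittleO_shift_expansion (k := k) h₂ h₃ h₄
  refine (e1.add e2).congr_left fun s => ?_
  obtain ⟨hi, he⟩ := integral_displacedTaylor hY hmean hsq v f₀ f₁ f₂ f₃
    (shift c₂ c₃ (c₄ + k) s) s
  have hFi : Integrable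
      (fun ω => F (q + displacement v (shift c₂ c₃ (c₄ + k) s) (s * Y ω))) P := by
    refine Integrable.of_bound (C := 1) (Measurable.aestronglyMeasurable ?_)
      (ae_of_all _ fun ω => ?_)
    · unfold displacement; fun_prop
    · rw [Real.norm_of_nonneg (h0 _)]; exact h1 _
  have hFq : Integrable (fun _ : Ω => F q) P := integrable_const _
  have hFd : Integrable
      (fun ω => F (q + displacement v (shift c₂ c₃ (c₄ + k) s) (s * Y ω)) - F q) P := hFi.sub hFq
  rw [integral_sub hFd hi, integral_sub hFi hFq, he]
  simp only [integral_const, probReal_univ, one_smul]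
  ring

end VaRExpansion

open VaRExpansion

theorem mainTheorem10 {Ω : Type*} [MeasurableSpace Ω] (P : Measure Ω) [IsProbabilityMeasure P]
    (X L : Ω → ℝ) (hX : Measurable X) (hL : Measurable L)
    (hXpos : ∀ᵐ ω ∂P, 0 < X ω) (hindep : IndepFun X L P)
    (hXinv : Integrable (fun ω => (X ω)⁻¹) P) (hLint : Integrable L P)
    (hXmean : ∫ ω, X ω ∂P = 1) (hLmean : ∫ ω, L ω ∂P = 0)
    (hX4 : MemLp X 4 P) (hXvar : 0 < variance X P)
    (f : ℝ → ℝ) (hfmeas : Measurable f) (hfpos : ∀ x, 0 < f x) (hfbdd : ∃ C, ∀ x, f x ≤ C)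
    (hfdens : P.map L = volume.withDensity (fun x => ENNReal.ofReal (f x)))
    (a : ℝ) (ha : a ∈ Set.Ioo (0 : ℝ) 1) (φ : ℝ) (hφ : 0 ≤ φ)
    (q : ℝ) (hq : q = VaRExpansion.quantile (P.map L) (1 - a))
    (hfsmooth : ContDiffAt ℝ 3 f q) :
    (fun s : ℝ =>
        VaRExpansion.valueAtRisk P a
            (VaRExpansion.surplus (VaRExpansion.assetWithVolatility P X s) L φ)
          - (q - 1 / f q *
              (s ^ 2 / 2 * deriv (VaRExpansion.weighted φ f 2) q
                + s ^ 3 * VaRExpansion.normalizedMoment P X 3 / 6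
                    * iteratedDeriv 2 (VaRExpansion.weighted φ f 3) q
                + s ^ 4 / 24
                    * deriv (fun y =>
                        VaRExpansion.normalizedMoment P X 4
                            * iteratedDeriv 2 (VaRExpansion.weighted φ f 4) y
                          - 3 * (deriv (VaRExpansion.weighted φ f 2) y ^ 2 / f y)) q)))
      =o[𝓝[>] (0 : ℝ)] (fun s : ℝ => s ^ 4) := by
  have : IsProbabilityMeasure (P.map L) := Measure.isProbabilityMeasure_map hL.aemeasurable
  have hf0 : f q ≠ 0 := (hfpos q).ne'
  obtain ⟨d₁, d₂, d₃, hcont⟩ := eventually_hasDerivAt_of_contDiffAt hfsmooth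
  have d₀ : ∀ᶠ x in 𝓝 q, HasDerivAt (cdf (P.map L)) (f x) x :=
    (hfsmooth.eventually (by simp)).mono fun x hx =>
      hasDerivAt_cdf_of_withDensity hfmeas hfpos hfdens hx.continuousAt
  have hFq : cdf (P.map L) q = 1 - a := by
    rw [hq]
    exact cdf_quantile (continuous_cdf_of_withDensity hfmeas hfpos hfdens)
      (by linarith [ha.2]) (by linarith [ha.1])
  rw [deriv_fourth_order_coefficient _ hf0 d₁ d₂ d₃.self_of_nhds,
    (deriv_weighted_eventuallyEq 2 d₁).self_of_nhds,
    (iteratedDeriv_two_weighted_eventuallyEq 3 d₁ d₂).self_of_nhds]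
  set f₁ := deriv f q with hf₁
  set f₂ := deriv (deriv f) q with hf₂
  set f₃ := deriv (deriv (deriv f)) q with hf₃
  set μ₃ := normalizedMoment P X 3 with hμ₃
  set μ₄ := normalizedMoment P X 4 with hμ₄
  set v := φ - q with hv
  -- The system `h₂`, `h₃`, `h₄` is triangular with diagonal entry `f q`, hence solvable in turn.
  -- Introducing the solutions through existentials keeps them opaque until the final comparison.
  obtain ⟨c₂, hc₂⟩ : ∃ c, c = -(-2 * v * f q + v ^ 2 * f₁) / (2 * f q) := ⟨_, rfl⟩
  obtain ⟨c₃, hc₃⟩ : ∃ c, c = -(6 * v * f q - 6 * v ^ 2 * f₁ + v ^ 3 * f₂) * μ₃ / (6 * f q) :=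
    ⟨_, rfl⟩
  obtain ⟨c₄, hc₄⟩ : ∃ c, c = -(f₁ / 2 * c₂ ^ 2 + (2 * f q - 4 * v * f₁ + v ^ 2 * f₂) / 2 * c₂
      + (-24 * v * f q + 36 * v ^ 2 * f₁ - 12 * v ^ 3 * f₂ + v ^ 4 * f₃) / 24 * μ₄) / f q :=
    ⟨_, rfl⟩
  have h₂ : f q * c₂ + (-2 * v * f q + v ^ 2 * f₁) / 2 = 0 := by rw [hc₂]; field_simp; ring
  have h₃ : f q * c₃ + (6 * v * f q - 6 * v ^ 2 * f₁ + v ^ 3 * f₂) / 6 * μ₃ = 0 := by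
    rw [hc₃]; field_simp; ring
  have h₄ : f q * c₄ + f₁ / 2 * c₂ ^ 2 + (2 * f q - 4 * v * f₁ + v ^ 2 * f₂) / 2 * c₂
      + (-24 * v * f q + 36 * v ^ 2 * f₁ - 12 * v ^ 3 * f₂ + v ^ 4 * f₃) / 24 * μ₄ = 0 := by
    rw [hc₄]; field_simp; ring
  have hYm : Measurable (normalizedAsset P X) := by unfold normalizedAsset; fun_prop
  have key := isLittleO_integral_displaced hYm (memLp_normalizedAsset hX4)
    (integral_normalizedAsset (hX4.integrable (by norm_num)) hXmean)
    (integral_normalizedAsset_sq hX.aemeasurable hXmean hXvar)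
    (monotone_cdf (P.map L)).measurable (cdf_nonneg _) (cdf_le_one _)
    (isLittleO_displaced_sub v d₀ d₁ d₂ d₃ hcont) h₂ h₃ h₄
  have main := isLittleO_valueAtRisk_sub (P := P) (a := a) (m := fun s => q + shift c₂ c₃ c₄ s)
    (Z := fun s => surplus (assetWithVolatility P X s) L φ) (hfpos q) (fun k => by
      -- The sign flips because the shortfall probability minus `a` equals `F q` minus the expected
      -- value of `F`.
      refine (key k).neg_left.congr' ?_ EventuallyEq.rfl
      filter_upwards [eventually_ae_one_add_mul_normalizedAsset_pos hXpos hXvar] with s hs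
      rw [measureReal_surplus_add_lt hX hL hindep φ q _ s hs, hFq]
      have e : q + shift c₂ c₃ c₄ s + k * s ^ 4 - q = shift c₂ c₃ (c₄ + k) s := by
        unfold shift; ring
      rw [e]
      ring)
  refine main.congr_left fun s => ?_
  congr 1
  -- With `A` and `B` the first and second derivatives of `(φ - id) ^ 2 f` at `q`, inserting `c₂ =
  -- -A / (2 * f q)` into `c₄` yields `-3 / 24` times the derivative `2 * A * B / f q - A ^ 2 * f₁ /
  -- f q ^ 2` of the quotient, up to the overall factor `-1 / f q`.
  rw [shift, hc₄, hc₃, hc₂]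
  norm_num
  field_simp
  ring
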